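/- Setting. Let $S$ be an Abelian semitopological semigroup, written additively: a Hausdorff space with a commutative, associative, separately continuous addition and a unit. Let $X$ be a complex Banach space and $Y \subset X^*$ a linear subspace (with the dual norm). A family $\{T(t)\}_{t\in S}\subset L(Y)$ is called a dual representation on $Y$ if (1) $T(s+t)=T(s)T(t)$ for all $s,t\in S$; (2) for all $x\in X$, $y\in Y$, the function $s\mapsto\langle x,T(s)y\rangle$ is continuous on $S$; (3) $\overline{\{T(t)y:t\in S\}}^{w^*}\subset Y$ for all $y\in Y$; (4) for all $s\in S$, $y\in Y$, the set $K_y:=\overline{\mathrm{ac}\{T(t)y:t\in S\}}^{w^*}$ (the weak-star closed absolutely convex hull of the orbit) is contained in $Y$, and $T(s)$ maps $K_y$ into $K_y$ and is continuous on $K_y$ from the weak-star topology to the weak-star topology. Assume moreover that the representation is bounded, $\sup_{t\in S}\|T(t)\|<\infty$. Give $L(Y,X^*)\supset L(Y)$ the topology of pointwise convergence $\langle x,A_iy\rangle\to\langle x,Ay\rangle$ for $x\in X$, $y\in Y$ (on bounded sets this is the weak-star topology of $L(Y,X^*)=(Y\otimes_\pi X)^*$), and let $\mathcal T\subset L(Y)$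 and $\overline{\mathrm{ac}}^{w^*}\{T(t)\}_{t\in S}\subset L(Y)$ be the closure of $\{T(t)\}_{t\in S}$, respectively of its absolutely convex hull, in that topology. Let $W(S)$ be the set of Eberlein-weakly almost periodic functions: the $f\in C_b(S)$ (bounded continuous complex functions) whose set of translates $\{f(t+\cdot):t\in S\}$ is relatively $\sigma(C_b(S),C_b(S)^*)$-compact. A set $M\subset X$ is separating if $z\in Y$ and $\langle x,z\rangle=0$ for all $x\in M$ imply $z=0$. Theorem 3.13. Let $\{T(t)\}_{t\in S}$ be a bounded dual representation on $Y$ and let $y\in Y$. Then $$UVy=VUy\quad\text{for all }U,V\in\mathcal T$$ if and only if there is a separating set $M\subset X$ such that for every $x\in M$ the function $s\mapsto\langle x,T(s)y\rangle$ belongs to $W(S)$. Moreover, in this case $UVy=VUy$ for all $U,V\in\overline{\mathrm{ac}}^{w^*}\{T(t)\}_{t\in S}$. -/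

import Mathlib

open scoped BoundedContinuousFunction ComplexOrder Topology

namespace DualRep

noncomputable section

/-! ### Eberlein-weakly almost periodic scalar functions -/

section Functions

variable {S : Type*} [TopologicalSpace S] [AddCommMonoid S] [SeparatelyContinuousAdd S]

/-- The translate `f_t : s ↦ f (t + s)` of a bounded continuous function. -/
def translate (f : S →ᵇ ℂ) (t : S) : S →ᵇ ℂ :=
  f.compContinuous ⟨fun s => t + s, continuous_const_add t⟩

/-- `g : S → ℂ` belongs to `W(S)`: it is bounded and continuous, and its orbit under translations
is relatively compact in `C_b(S)` for the weak topology `σ(C_b(S), C_b(S)^*)`. -/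
def IsEberleinWAP (g : S → ℂ) : Prop :=
  ∃ f : S →ᵇ ℂ, (∀ s, f s = g s) ∧
    IsCompact (closure (Set.range fun t : S => toWeakSpace ℂ (S →ᵇ ℂ) (translate f t)))

end Functions

section Representations

variable {X : Type*} [NormedAddCommGroup X] [NormedSpace ℂ X]

/-- The inclusion of a subspace `Y ⊂ X^*` into `X^*` with its weak-star topology `σ(X^*, X)`. -/
def toWStar (Y : Submodule ℂ (StrongDual ℂ X)) (y : Y) : WeakDual ℂ X :=
  StrongDual.toWeakDual (y : StrongDual ℂ X)

/-- The weak-star topology of `X^*`, restricted to the subspace `Y`. -/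
abbrev wStarTopology (Y : Submodule ℂ (StrongDual ℂ X)) : TopologicalSpace Y :=
  TopologicalSpace.induced (toWStar Y) inferInstance

/-- The topology on `L(Y, X^*)` in which `A_i → A` if and only if `⟨x, A_i y⟩ → ⟨x, A y⟩` for all
`y ∈ Y` and `x ∈ X`. On norm bounded sets it is the weak-star topology of
`L(Y, X^*) = (Y ⊗_π X)^*`. -/
abbrev wStarOperatorTopology (Y : Submodule ℂ (StrongDual ℂ X)) :
    TopologicalSpace (Y →L[ℂ] StrongDual ℂ X) :=
  TopologicalSpace.induced
    (fun A => fun y : Y => (StrongDual.toWeakDual (A y) : WeakDual ℂ X)) Pi.topologicalSpace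

/-- The embedding `L(Y) ⊂ L(Y, X^*)`. -/
def toOpDual (Y : Submodule ℂ (StrongDual ℂ X)) (A : Y →L[ℂ] Y) : Y →L[ℂ] StrongDual ℂ X :=
  Y.subtypeL.comp A

variable {S : Type*}

/-- The orbit `O(y) = {T(t) y : t ∈ S}`, as a subset of `(X^*, w^*)`. -/
def orbit (Y : Submodule ℂ (StrongDual ℂ X)) (T : S → Y →L[ℂ] Y) (y : Y) : Set (WeakDual ℂ X) :=
  Set.range fun t : S => toWStar Y (T t y)

/-- The weak-star closure of the (complex) absolutely convex hull of the orbit of `y`. -/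
def orbitHull (Y : Submodule ℂ (StrongDual ℂ X)) (T : S → Y →L[ℂ] Y) (y : Y) :
    Set (WeakDual ℂ X) :=
  closure (absConvexHull ℂ (orbit Y T y))

/-- Dual semigroup representations `{T(t)}_{t ∈ S} ⊂ L(Y)` on a subspace `Y ⊂ X^*`. The requirement
that `T(s)` is a continuous self-map of `(orbitHull y, w^*)` is spelled out in the last three
fields: the hull lies in the domain `Y` of `T(s)`, is mapped into itself, and `T(s)` is
weak-star to weak-star continuous on it. -/
structure IsDualRepresentation [TopologicalSpace S] [AddCommMonoid S]
    (Y : Submodule ℂ (StrongDual ℂ X)) (T : S → Y →L[ℂ] Y) : Prop where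
  map_add : ∀ s t : S, T (s + t) = (T s).comp (T t)
  continuous_coeff : ∀ (x : X) (y : Y), Continuous fun s : S => (T s y : StrongDual ℂ X) x
  closure_orbit_subset : ∀ y : Y, closure (orbit Y T y) ⊆ Set.range (toWStar Y)
  orbitHull_subset : ∀ y : Y, orbitHull Y T y ⊆ Set.range (toWStar Y)
  mapsTo_orbitHull : ∀ (s : S) (y : Y),
    Set.MapsTo (T s) (toWStar Y ⁻¹' orbitHull Y T y) (toWStar Y ⁻¹' orbitHull Y T y)
  continuousOn_orbitHull : ∀ (s : S) (y : Y),
    @ContinuousOn Y Y (wStarTopology Y) (wStarTopology Y) (T s) (toWStar Y ⁻¹' orbitHull Y T y)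

/-- The compactification `𝒯`: the weak-star closure of `{T(t) : t ∈ S} ⊂ L(Y, X^*)`, viewed in
`L(Y)`. -/
def compactification (Y : Submodule ℂ (StrongDual ℂ X)) (T : S → Y →L[ℂ] Y) : Set (Y →L[ℂ] Y) :=
  {U | toOpDual Y U ∈ closure[wStarOperatorTopology Y] (Set.range fun t : S => toOpDual Y (T t))}

/-- The weak-star closed (complex) absolutely convex hull of `{T(t) : t ∈ S} ⊂ L(Y, X^*)`, viewed
in `L(Y)`. -/
def compactificationHull (Y : Submodule ℂ (StrongDual ℂ X)) (T : S → Y →L[ℂ] Y) :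
    Set (Y →L[ℂ] Y) :=
  {U | toOpDual Y U ∈ closure[wStarOperatorTopology Y]
    (absConvexHull ℂ (Set.range fun t : S => toOpDual Y (T t)))}

/-- A set `M ⊂ X` separates the points of `Y ⊂ X^*`. -/
def IsSeparating (Y : Submodule ℂ (StrongDual ℂ X)) (M : Set X) : Prop :=
  ∀ y : Y, (∀ x ∈ M, (y : StrongDual ℂ X) x = 0) → y = 0

end Representations

end

end DualRep

/-! The engine is Grothendieck's theorem: on a product of compact spaces, a bounded separately
continuous function is a weakly continuous map of one factor into the continuous functions on the
other. The representation extends to operators `U p`, `p` in the Stone–Čech compactification of `S`,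
each lying in `DualRep.compactification`. If these commute at `y`, then `(p, q) ↦ ⟨x, U q (U p y)⟩`
is symmetric, hence separately continuous, and Grothendieck's theorem makes its set of sections
weakly compact. Restricted to `S`, the sections at points of `S` are the translates of the
coefficient of `y`, so every `x` gives a weakly almost periodic function and `M = X` separates.

Conversely, weak compactness of the translates gives an interchange of limits: a weak limit of
translates along the filter defining `U`, paired with a weak-star limit of evaluations along the
filter defining `V`, computes both `⟨x, U V y⟩` and `⟨x, V U y⟩`.

For the hulls, operators become functionals on the continuous functions on the compactification, and
`V (W y) = W (V y)` becomes the Fubini identity `strongDual_fubini_of_separately_continuous`. In the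
last two arguments, members of the closures commute with each `T t` because `T t` is weak-star
continuous on orbit hulls. -/

/-! ### Dominated convergence for functionals on continuous functions. -/

-- The measure represents the positive part of `φ`, given on `f ≥ 0` by the supremum of `φ g` over
-- `0 ≤ g ≤ f`; this supremum is additive and positively homogeneous, so the Riesz–Markov theorem
-- applies.
open Filter MeasureTheory CompactlySupported in
theorem exists_finite_measure_dominating {L : Type*} [TopologicalSpace L] [CompactSpace L]
    [T2Space L] [MeasurableSpace L] [BorelSpace L] (φ : StrongDual ℝ C(L, ℝ)) :
    ∃ μ : Measure L, IsFiniteMeasure μ ∧ ∀ f : C(L, ℝ), 0 ≤ f → φ f ≤ ∫ x, f x ∂μ := by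
  let A : C_c(L, NNReal) → Set ℝ := fun f =>
    {r | ∃ g : C(L, ℝ), 0 ≤ g ∧ (∀ x, g x ≤ f x) ∧ φ g = r}
  have hne : ∀ f, (0 : ℝ) ∈ A f := fun f =>
    ⟨0, le_rfl, fun x => by simp, by simp⟩
  have hbdd : ∀ f, BddAbove (A f) := by
    intro f
    let F : C(L, ℝ) := ⟨fun x => (f x : ℝ), by fun_prop⟩
    refine ⟨‖φ‖ * ‖F‖, ?_⟩
    rintro r ⟨g, hg0, hg, rfl⟩
    refine (le_abs_self _).trans ((φ.le_opNorm g).trans ?_)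
    gcongr
    rw [ContinuousMap.norm_le _ (norm_nonneg _)]
    intro x
    have h0 : 0 ≤ g x := hg0 x
    rw [Real.norm_of_nonneg h0]
    exact (hg x).trans ((le_abs_self _).trans (F.norm_coe_le_norm x))
  have hnn : ∀ f, 0 ≤ sSup (A f) := fun f => le_csSup (hbdd f) (hne f)
  have hadd : ∀ f₁ f₂, sSup (A (f₁ + f₂)) = sSup (A f₁) + sSup (A f₂) := by
    intro f₁ f₂
    apply le_antisymm
    · refine csSup_le ⟨0, hne _⟩ ?_
      rintro r ⟨g, hg0, hg, rfl⟩
      let F : C(L, ℝ) := ⟨fun x => (f₁ x : ℝ), by fun_prop⟩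
      -- Riesz decomposition: `g ≤ f₁ + f₂` splits as `g ⊓ f₁` plus a remainder between `0` and
      -- `f₂`.
      have h1 : φ (g ⊓ F) ∈ A f₁ := ⟨g ⊓ F, le_inf hg0 (fun x => (f₁ x).2), fun x => by
        simp [F], rfl⟩
      have h2 : φ (g - g ⊓ F) ∈ A f₂ := ⟨g - g ⊓ F, sub_nonneg.2 inf_le_left, fun x => by
        have h3 := hg x
        have h4 : (0 : ℝ) ≤ f₂ x := (f₂ x).2
        simp only [CompactlySupportedContinuousMap.coe_add, Pi.add_apply, NNReal.coe_add] at h3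
        simp only [ContinuousMap.sub_apply, ContinuousMap.inf_apply, F, ContinuousMap.coe_mk]
        rcases le_total (g x) (f₁ x) with h | h
        · rw [inf_eq_left.2 h]; linarith
        · rw [inf_eq_right.2 h]; linarith, rfl⟩
      have := add_le_add (le_csSup (hbdd _) h1) (le_csSup (hbdd _) h2)
      simpa using this
    · rw [← le_sub_iff_add_le]
      refine csSup_le ⟨0, hne _⟩ ?_
      rintro r ⟨g, hg0, hg, rfl⟩
      rw [le_sub_comm]
      refine csSup_le ⟨0, hne _⟩ ?_
      rintro r ⟨g', hg0', hg', rfl⟩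
      rw [le_sub_iff_add_le, ← map_add]
      refine le_csSup (hbdd _) ⟨g' + g, add_nonneg hg0' hg0, fun x => ?_, rfl⟩
      have h3 := hg x
      have h4 := hg' x
      simp only [CompactlySupportedContinuousMap.coe_add, Pi.add_apply, NNReal.coe_add,
        ContinuousMap.add_apply]
      linarith
  have hsmul_le : ∀ (c : NNReal) f, c ≠ 0 → (c : ℝ) * sSup (A f) ≤ sSup (A (c • f)) := by
    intro c f hc
    have hc' : (0 : ℝ) < c := by positivity
    rw [← le_div_iff₀' hc']
    refine csSup_le ⟨0, hne _⟩ ?_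
    rintro r ⟨g, hg0, hg, rfl⟩
    rw [le_div_iff₀' hc']
    refine le_csSup (hbdd _) ⟨(c : ℝ) • g, smul_nonneg c.2 hg0, fun x => ?_, by simp⟩
    simp only [ContinuousMap.smul_apply, smul_eq_mul, CompactlySupportedContinuousMap.coe_smul,
      Pi.smul_apply, NNReal.coe_mul]
    exact mul_le_mul_of_nonneg_left (hg x) c.2
  have hsmul : ∀ (c : NNReal) f, sSup (A (c • f)) = (c : ℝ) * sSup (A f) := by
    intro c f
    rcases eq_or_ne c 0 with rfl | hc
    · rw [zero_smul]
      have := hadd 0 0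
      rw [add_zero] at this
      simp; linarith
    · refine le_antisymm ?_ (hsmul_le c f hc)
      have h := hsmul_le c⁻¹ (c • f) (inv_ne_zero hc)
      rw [smul_smul, inv_mul_cancel₀ hc, one_smul, NNReal.coe_inv] at h
      have hc' : (0 : ℝ) < c := by positivity
      rwa [inv_mul_le_iff₀ hc'] at h
  let Λ : C_c(L, NNReal) →ₗ[NNReal] NNReal :=
    { toFun := fun f => ⟨sSup (A f), hnn f⟩
      map_add' := fun f g => NNReal.eq (hadd f g)
      map_smul' := fun c f => NNReal.eq (hsmul c f) }
  refine ⟨NNRealRMK.rieszMeasure Λ, inferInstance, fun f hf => ?_⟩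
  let f' : C_c(L, NNReal) := CompactlySupportedContinuousMap.continuousMapEquiv
    ⟨fun x => ⟨f x, hf x⟩, by fun_prop⟩
  have h1 : ∫ x, f x ∂(NNRealRMK.rieszMeasure Λ) = Λ f' :=
    NNRealRMK.integral_rieszMeasure Λ f'
  rw [h1]
  exact le_csSup (hbdd f') ⟨f, hf, fun x => le_rfl, rfl⟩

open Filter MeasureTheory in
/-- The nonnegative case of the dominated convergence theorem for bounded functionals on `C(L)`. -/
theorem tendsto_strongDual_real_of_nonneg {L : Type*} [TopologicalSpace L] [CompactSpace L]
    [T2Space L] (φ : StrongDual ℝ C(L, ℝ)) (g : ℕ → C(L, ℝ)) (C : ℝ) (hg0 : ∀ n, 0 ≤ g n)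
    (hgC : ∀ n x, g n x ≤ C) (hg : ∀ x, Tendsto (fun n => g n x) atTop (𝓝 0)) :
    Tendsto (fun n => φ (g n)) atTop (𝓝 0) := by
  let mL : MeasurableSpace L := borel L
  have bL : BorelSpace L := ⟨rfl⟩
  have key : ∀ μ : Measure L, IsFiniteMeasure μ →
      Tendsto (fun n => ∫ x, g n x ∂μ) atTop (𝓝 0) := by
    intro μ hμ
    have := tendsto_integral_of_dominated_convergence (μ := μ) (F := fun n x => g n x)
      (f := fun _ => (0 : ℝ)) (fun _ => C)
      (fun n => (g n).continuous.measurable.aestronglyMeasurable) (integrable_const _)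
      (fun n => Eventually.of_forall fun x => by
        exact (Real.norm_of_nonneg (hg0 n x)).trans_le (hgC n x))
      (Eventually.of_forall hg)
    simpa using this
  obtain ⟨μ, hμ, h1⟩ := exists_finite_measure_dominating φ
  obtain ⟨ν, hν, h2⟩ := exists_finite_measure_dominating (-φ)
  have h3 := (key ν hν).neg
  rw [neg_zero] at h3
  -- Dominating both `φ` and `-φ` squeezes `φ (g n)` between two integrals that tend to zero.
  refine tendsto_of_tendsto_of_tendsto_of_le_of_le h3 (key μ hμ) (fun n => ?_)
    (fun n => h1 _ (hg0 n))
  have := h2 _ (hg0 n)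
  simp only [neg_apply] at this
  show -∫ x, g n x ∂ν ≤ φ (g n)
  linarith

open Filter in
theorem tendsto_strongDual_real_of_tendsto_pointwise {L : Type*} [TopologicalSpace L]
    [CompactSpace L] [T2Space L] (φ : StrongDual ℝ C(L, ℝ)) (g : ℕ → C(L, ℝ)) (C : ℝ)
    (hgC : ∀ n x, |g n x| ≤ C) (hg : ∀ x, Tendsto (fun n => g n x) atTop (𝓝 0)) :
    Tendsto (fun n => φ (g n)) atTop (𝓝 0) := by
  have h1 := tendsto_strongDual_real_of_nonneg φ (fun n => g n ⊔ 0) C (fun n => le_sup_right)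
    (fun n x => by
      simpa using ⟨(le_abs_self _).trans (hgC n x), (abs_nonneg _).trans (hgC n x)⟩)
    (fun x => by simpa using (hg x).max (tendsto_const_nhds (x := (0 : ℝ))))
  have h2 := tendsto_strongDual_real_of_nonneg φ (fun n => (-g n) ⊔ 0) C (fun n => le_sup_right)
    (fun n x => by
      simpa using ⟨(neg_le_abs _).trans (hgC n x), (abs_nonneg _).trans (hgC n x)⟩)
    (fun x => by simpa using (hg x).neg.max (tendsto_const_nhds (x := (0 : ℝ))))
  have h3 := h1.sub h2
  simp only [← map_sub, sub_zero] at h3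
  refine h3.congr fun n => congrArg φ ?_
  ext x
  simp only [ContinuousMap.sub_apply, ContinuousMap.sup_apply, ContinuousMap.zero_apply,
    ContinuousMap.neg_apply]
  rcases le_total (g n x) 0 with h | h
  · rw [sup_eq_right.2 h, sup_eq_left.2 (by linarith)]; ring
  · rw [sup_eq_left.2 h, sup_eq_right.2 (by linarith)]; ring

/-- The restriction of a complex functional on `C(L, ℂ)` to real functions, followed by a real
functional on `ℂ`. -/
noncomputable def realPartDual {L : Type*} [TopologicalSpace L] [CompactSpace L]
    (φ : StrongDual ℂ C(L, ℂ)) (r : ℂ →L[ℝ] ℝ) : StrongDual ℝ C(L, ℝ) :=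
  r ∘L (φ.restrictScalars ℝ) ∘L (Complex.ofRealCLM.compLeftContinuous ℝ L)

open Filter in
theorem tendsto_strongDual_of_tendsto_pointwise {L : Type*} [TopologicalSpace L]
    [CompactSpace L] [T2Space L] (φ : StrongDual ℂ C(L, ℂ)) (g : ℕ → C(L, ℂ)) (C : ℝ)
    (hgC : ∀ n x, ‖g n x‖ ≤ C) (hg : ∀ x, Tendsto (fun n => g n x) atTop (𝓝 0)) :
    Tendsto (fun n => φ (g n)) atTop (𝓝 0) := by
  let J : C(L, ℝ) →L[ℝ] C(L, ℂ) := Complex.ofRealCLM.compLeftContinuous ℝ L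
  have key : ∀ h : ℕ → C(L, ℝ), (∀ n x, |h n x| ≤ C) →
      (∀ x, Tendsto (fun n => h n x) atTop (𝓝 0)) →
      Tendsto (fun n => φ (J (h n))) atTop (𝓝 0) := by
    intro h hC hh
    have h1 := tendsto_strongDual_real_of_tendsto_pointwise (realPartDual φ Complex.reCLM) h C hC hh
    have h2 := tendsto_strongDual_real_of_tendsto_pointwise (realPartDual φ Complex.imCLM) h C hC hh
    have h3 := ((Complex.continuous_ofReal.tendsto 0).comp h1).add
      (((Complex.continuous_ofReal.tendsto 0).comp h2).mul_const Complex.I)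
    simp only [Complex.ofReal_zero, zero_mul, add_zero] at h3
    exact h3.congr fun n => Complex.re_add_im _
  let re : ℕ → C(L, ℝ) := fun n => ⟨fun x => (g n x).re, by fun_prop⟩
  let im : ℕ → C(L, ℝ) := fun n => ⟨fun x => (g n x).im, by fun_prop⟩
  have h1 := key re (fun n x => (Complex.abs_re_le_norm _).trans (hgC n x))
    (fun x => (Complex.continuous_re.tendsto 0).comp (hg x))
  have h2 := key im (fun n x => (Complex.abs_im_le_norm _).trans (hgC n x))
    (fun x => (Complex.continuous_im.tendsto 0).comp (hg x))
  have h3 := h1.add (h2.const_mul Complex.I)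
  simp only [mul_zero, add_zero] at h3
  refine h3.congr fun n => ?_
  rw [← smul_eq_mul, ← map_smul, ← map_add]
  congr 1
  ext x
  show ((g n x).re : ℂ) + Complex.I * ((g n x).im : ℂ) = g n x
  rw [mul_comm, Complex.re_add_im]

/-! ### Grothendieck's theorem on separately continuous functions. -/

open Filter in
/-- If `k₀` is in the closure of `A`, then a sequence in `A` converges to `k₀` when tested against
a separately continuous function. -/
theorem exists_seq_tendsto_of_separately_continuous {K L : Type*} [TopologicalSpace K]
    [CompactSpace K] [TopologicalSpace L] [CompactSpace L] (F : K → L → ℂ)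
    (hK : ∀ l, Continuous fun k => F k l) (hL : ∀ k, Continuous (F k)) {A : Set K} {k₀ : K}
    (hk₀ : k₀ ∈ closure A) :
    ∃ k : ℕ → K, (∀ n, k n ∈ A) ∧ ∀ l, Tendsto (fun n => F (k n) l) atTop (𝓝 (F k₀ l)) := by
  classical
  have hnet : ∀ (J : Finset K) (n : ℕ), ∃ E : Finset L, ∀ l, ∃ l' ∈ E, ∀ k ∈ J,
      dist (F k l) (F k l') < 1 / ((n : ℝ) + 1) := by
    intro J n
    obtain ⟨E, -, hE⟩ := isCompact_univ.elim_nhds_subcover (X := L)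
      (fun l' => {l | ∀ k ∈ J, dist (F k l) (F k l') < 1 / ((n : ℝ) + 1)}) (fun l' _ => by
        refine (Filter.eventually_all_finset J).2 fun k _ => ?_
        exact (hL k).continuousAt (Metric.ball_mem_nhds _ Nat.one_div_pos_of_nat))
    refine ⟨E, fun l => ?_⟩
    have := hE (Set.mem_univ l)
    simpa only [Set.mem_iUnion, Set.mem_ofPred_eq, exists_prop] using this
  have hnext : ∀ (E : Finset L) (n : ℕ), ∃ k ∈ A, ∀ l ∈ E,
      dist (F k l) (F k₀ l) < 1 / ((n : ℝ) + 1) := by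
    intro E n
    have h : {k | ∀ l ∈ E, dist (F k l) (F k₀ l) < 1 / ((n : ℝ) + 1)} ∈ 𝓝 k₀ :=
      (Filter.eventually_all_finset E).2 fun l _ =>
        (hK l).continuousAt (Metric.ball_mem_nhds _ Nat.one_div_pos_of_nat)
    obtain ⟨k, hk, hkA⟩ := mem_closure_iff_nhds.1 hk₀ _ h
    exact ⟨k, hkA, hk⟩
  choose net hnet using hnet
  choose next hnextA hnext using hnext
  -- Finite sets of points of `K` and `L` grow alternately: `net` approximates every `l` by a listed
  -- point, as seen by the listed `k`; `next` picks a point of `A` close to `k₀` on the listed `l`.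
  let st : ℕ → Finset K × Finset L := fun n => Nat.rec ({k₀}, ∅)
    (fun n p => (insert (next (p.2 ∪ net p.1 n) n) p.1, p.2 ∪ net p.1 n)) n
  let k : ℕ → K := fun n => next ((st n).2 ∪ net (st n).1 n) n
  have hst1 : ∀ n, (st (n + 1)).1 = insert (k n) (st n).1 := fun n => rfl
  have hst2 : ∀ n, (st (n + 1)).2 = (st n).2 ∪ net (st n).1 n := fun n => rfl
  have hmono1 : Monotone fun n => (st n).1 := monotone_nat_of_le_succ fun n => by
    rw [hst1]; exact Finset.subset_insert _ _
  have hmono2 : Monotone fun n => (st n).2 := monotone_nat_of_le_succ fun n => by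
    rw [hst2]; exact Finset.subset_union_left
  have hk0 : ∀ n, k₀ ∈ (st n).1 := fun n => hmono1 (Nat.zero_le n) (by simp [st])
  have hkm : ∀ m n, m < n → k m ∈ (st n).1 := fun m n h =>
    hmono1 (Nat.succ_le_of_lt h) (by simp only [Nat.succ_eq_add_one, hst1]; simp)
  have hconv : ∀ m, ∀ l ∈ net (st m).1 m, Tendsto (fun n => F (k n) l) atTop (𝓝 (F k₀ l)) := by
    intro m l hl
    rw [tendsto_iff_dist_tendsto_zero]
    refine squeeze_zero' (Eventually.of_forall fun _ => dist_nonneg) ?_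
      (tendsto_one_div_add_atTop_nhds_zero_nat (𝕜 := ℝ))
    filter_upwards [eventually_ge_atTop m] with n hn
    refine (hnext _ n l ?_).le
    rw [← hst2]
    exact hmono2 (Nat.succ_le_succ hn) (by
      simp only [Nat.succ_eq_add_one, hst2]; exact Finset.mem_union_right _ hl)
  refine ⟨k, fun n => hnextA _ _, fun l => ?_⟩
  -- Along an ultrafilter, `k n` tends to some `k'` and the net points `l' n` approximating `l` tend
  -- to some `l''`. The chain `F k₀ l = F k₀ l'' = F k' l'' = F k' l` identifies the limit, so no
  -- subsequence is needed.
  rw [tendsto_iff_ultrafilter]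
  intro 𝒰 h𝒰
  obtain ⟨k', -, hk'⟩ := isCompact_univ.ultrafilter_le_nhds (𝒰.map k) (by simp)
  have hk'' : ∀ l, Tendsto (fun n => F (k n) l) 𝒰 (𝓝 (F k' l)) := fun l =>
    ((hK l).tendsto k').comp hk'
  choose l' hl'mem hl' using fun n => hnet (st n).1 n l
  obtain ⟨l'', -, hl''⟩ := isCompact_univ.ultrafilter_le_nhds (𝒰.map l') (by simp)
  have hlim : ∀ κ, Tendsto (fun n => F κ (l' n)) 𝒰 (𝓝 (F κ l'')) := fun κ =>
    ((hL κ).tendsto l'').comp hl''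
  have hsame : ∀ κ, (∃ m, ∀ n, m < n → κ ∈ (st n).1) → F κ l'' = F κ l := by
    rintro κ ⟨m, hm⟩
    refine tendsto_nhds_unique (hlim κ) (Tendsto.mono_left ?_ h𝒰)
    rw [tendsto_iff_dist_tendsto_zero]
    refine squeeze_zero' (Eventually.of_forall fun _ => dist_nonneg) ?_
      (tendsto_one_div_add_atTop_nhds_zero_nat (𝕜 := ℝ))
    filter_upwards [eventually_gt_atTop m] with n hn
    rw [dist_comm]
    exact (hl' n κ (hm n hn)).le
  have e1 : F k' l = F k' l'' := by
    refine tendsto_nhds_unique (hk'' l) ((hk'' l'').congr fun m => ?_)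
    exact hsame _ ⟨m, fun n => hkm m n⟩
  have e2 : F k' l'' = F k₀ l'' := by
    refine tendsto_nhds_unique (hlim k') ((hlim k₀).congr fun n => ?_)
    exact tendsto_nhds_unique ((hconv n _ (hl'mem n)).mono_left h𝒰) (hk'' _)
  rw [← hsame k₀ ⟨0, fun n _ => hk0 n⟩, ← e2, ← e1]
  exact hk'' l

open Filter in
/-- **Grothendieck's theorem** on separately continuous functions: a bounded separately continuous
function on a product of compact spaces is a weakly continuous map of one factor into the continuous
functions on the other factor. -/
theorem continuous_strongDual_apply_of_separately_continuous {K L : Type*} [TopologicalSpace K]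
    [CompactSpace K] [TopologicalSpace L] [CompactSpace L] [T2Space L] (F : K → C(L, ℂ))
    (hK : ∀ l, Continuous fun k => F k l) {C : ℝ} (hC : ∀ k l, ‖F k l‖ ≤ C)
    (φ : StrongDual ℂ C(L, ℂ)) : Continuous fun k => φ (F k) := by
  rw [continuous_iff_continuousAt]
  intro k₀
  by_contra hcont
  rw [ContinuousAt, Metric.tendsto_nhds] at hcont
  push Not at hcont
  obtain ⟨ε, hε, hfreq⟩ := hcont
  obtain ⟨k, hkA, hk⟩ := exists_seq_tendsto_of_separately_continuous (fun k l => F k l) hK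
    (fun k => (F k).continuous) (mem_closure_iff_frequently.2 hfreq)
  have h := tendsto_strongDual_of_tendsto_pointwise φ (fun n => F (k n) - F k₀) (C + C)
    (fun n x => (norm_sub_le _ _).trans (add_le_add (hC _ _) (hC _ _)))
    -- The sequence stays where `φ ∘ F` is at least `ε` away from its value at `k₀`, yet converges
    -- pointwise and boundedly, against dominated convergence.
    (fun x => by simpa using (hk x).sub_const (F k₀ x))
  obtain ⟨n, hn⟩ := ((Metric.tendsto_nhds.1 h) ε hε).exists
  have h' : ε ≤ dist (φ (F (k n))) (φ (F k₀)) := hkA n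
  rw [map_sub, dist_zero_right, ← dist_eq_norm] at hn
  exact absurd hn h'.not_gt

/-! ### Functionals approximated by evaluations, and a Fubini identity. -/

theorem Ultrafilter.exists_tendsto_of_range_mem {α β : Type*} (𝒲 : Ultrafilter β) {g : α → β}
    (hg : Set.range g ∈ 𝒲) : ∃ 𝒰 : Ultrafilter α, Filter.Tendsto g 𝒰 𝒲 := by
  have hne : (Filter.comap g 𝒲).NeBot := Filter.NeBot.comap_of_range_mem 𝒲.neBot hg
  exact ⟨Ultrafilter.of (Filter.comap g 𝒲), Filter.tendsto_iff_comap.2 (Ultrafilter.of_le _)⟩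

theorem WeakDual.tendsto_iff_forall_apply {ι E : Type*} [NormedAddCommGroup E] [NormedSpace ℂ E]
    {l : Filter ι} {f : ι → WeakDual ℂ E} {φ : WeakDual ℂ E} :
    Filter.Tendsto f l (𝓝 φ) ↔ ∀ x, Filter.Tendsto (fun i => f i x) l (𝓝 (φ x)) :=
  tendsto_iff_forall_eval_tendsto_topDualPairing

/-- The evaluation functionals on `C(K, ℂ)`. -/
noncomputable def evalWeakDual (K : Type*) [TopologicalSpace K] [CompactSpace K] (k : K) :
    WeakDual ℂ C(K, ℂ) :=
  StrongDual.toWeakDual (ContinuousMap.evalCLM ℂ k)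

theorem evalWeakDual_apply {K : Type*} [TopologicalSpace K] [CompactSpace K] (k : K)
    (h : C(K, ℂ)) : evalWeakDual K k h = h k := rfl

theorem absConvexHull_evalWeakDual_subset {K : Type*} [TopologicalSpace K] [CompactSpace K] :
    absConvexHull ℂ (Set.range (evalWeakDual K)) ⊆
      WeakDual.toStrongDual ⁻¹' Metric.closedBall 0 1 := by
  refine absConvexHull_min ?_ ⟨?_, ?_⟩
  · rintro _ ⟨k, rfl⟩
    simp only [Set.mem_preimage, mem_closedBall_zero_iff]
    refine ContinuousLinearMap.opNorm_le_bound _ zero_le_one fun h => ?_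
    rw [one_mul]
    exact h.norm_coe_le_norm k
  · rw [balanced_iff_smul_mem]
    intro a ha u hu
    exact balanced_iff_smul_mem.1 (balanced_closedBall_zero (𝕜 := ℂ)) ha hu
  · exact (convex_RCLike_iff_convex_real.2 (convex_closedBall _ _)).linear_preimage
      (WeakDual.toStrongDual (𝕜 := ℂ) (E := C(K, ℂ))).toLinearMap

/-- The iterated functionals `φ ⊗ ψ` and `ψ ⊗ φ` agree on bounded separately continuous functions,
when `φ` is a weak-star limit of absolutely convex combinations of evaluations. -/
theorem strongDual_fubini_of_separately_continuous {K L : Type*} [TopologicalSpace K]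
    [CompactSpace K] [T2Space K] [TopologicalSpace L] [CompactSpace L] [T2Space L]
    (F : K → C(L, ℂ)) (G : L → C(K, ℂ)) (hFG : ∀ k l, F k l = G l k) {C : ℝ}
    (hC : ∀ k l, ‖F k l‖ ≤ C) (ψ : StrongDual ℂ C(L, ℂ)) {φ : WeakDual ℂ C(K, ℂ)}
    (hφ : φ ∈ closure (absConvexHull ℂ (Set.range (evalWeakDual K)))) (a : C(K, ℂ))
    (ha : ∀ k, a k = ψ (F k)) (b : C(L, ℂ)) (hb : ∀ l, b l = φ (G l)) : φ a = ψ b := by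
  have hcont : ∀ θ : WeakDual ℂ C(K, ℂ), Continuous fun l => θ (G l) := fun θ =>
    continuous_strongDual_apply_of_separately_continuous G
      (fun k => (F k).continuous.congr fun l => hFG k l)
      (fun l k => by rw [← hFG]; exact hC k l) (WeakDual.toStrongDual θ)
  let B : WeakDual ℂ C(K, ℂ) → C(L, ℂ) := fun θ => ⟨fun l => θ (G l), hcont θ⟩
  let W : Set (WeakDual ℂ C(K, ℂ)) := WeakDual.toStrongDual ⁻¹' Metric.closedBall 0 1
  have hW : IsCompact W := WeakDual.isCompact_closedBall _ _
  have : CompactSpace W := isCompact_iff_compactSpace.1 hW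
  -- Grothendieck's theorem again, now with the weak-star compact unit ball as first factor. The
  -- bound uses `max C 0` since `C` may be negative when `K` is empty.
  have hBW : Continuous fun θ : W => ψ (B θ) := by
    refine continuous_strongDual_apply_of_separately_continuous (C := 1 * max C 0)
      (fun θ : W => B θ)
      (fun l => (WeakDual.eval_continuous (G l)).comp continuous_subtype_val) ?_ ψ
    intro θ l
    have hG : ‖G l‖ ≤ max C 0 := by
      rw [ContinuousMap.norm_le _ (le_max_right _ _)]
      intro k
      rw [← hFG]
      exact (hC k l).trans (le_max_left _ _)
    have hθ : ‖WeakDual.toStrongDual θ.1‖ ≤ 1 := mem_closedBall_zero_iff.1 θ.2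
    refine ((WeakDual.toStrongDual θ.1).le_opNorm (G l)).trans ?_
    gcongr
  -- Continuity of `θ ↦ ψ (B θ)` is known only on the ball; compactness of the ball makes this
  -- solution set closed in the whole dual.
  let Z : Set (WeakDual ℂ C(K, ℂ)) := Subtype.val '' {θ : W | θ.1 a = ψ (B θ)}
  have hZ : IsClosed Z := by
    have h1 : IsClosed {θ : W | θ.1 a = ψ (B θ)} :=
      isClosed_eq ((WeakDual.eval_continuous a).comp continuous_subtype_val) hBW
    exact (h1.isCompact.image continuous_subtype_val).isClosed
  have hsub : absConvexHull ℂ (Set.range (evalWeakDual K)) ⊆ {θ | θ a = ψ (B θ)} := by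
    refine absConvexHull_min ?_ ⟨?_, ?_⟩
    · rintro _ ⟨k, rfl⟩
      show a k = ψ (B _)
      rw [ha]
      congr 1
      ext l
      exact hFG k l
    · rw [balanced_iff_smul_mem]
      intro c _ u hu
      have : B (c • u) = c • B u := rfl
      show c • u a = ψ (B (c • u))
      rw [this, map_smul]
      exact congrArg (c • ·) hu
    · intro u hu v hv c d _ _ _
      have : B (c • u + d • v) = c • B u + d • B v := rfl
      show c • u a + d • v a = ψ (B (c • u + d • v))
      rw [this, map_add, map_smul, map_smul]
      exact congrArg₂ (fun r s => c • r + d • s) hu hv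
  have hsubZ : absConvexHull ℂ (Set.range (evalWeakDual K)) ⊆ Z := fun θ hθ =>
    ⟨⟨θ, absConvexHull_evalWeakDual_subset hθ⟩, hsub hθ, rfl⟩
  have hφZ : φ ∈ Z := closure_minimal hsubZ hZ hφ
  obtain ⟨θ, hθ, rfl⟩ := hφZ
  rw [Set.mem_ofPred_eq] at hθ
  rw [hθ]
  congr 1
  ext l
  exact (hb l).symm

/-! ### Weak-star limits of the representation. -/

namespace DualRep

variable {X : Type*} [NormedAddCommGroup X] [NormedSpace ℂ X] {Y : Submodule ℂ (StrongDual ℂ X)}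

theorem toWStar_injective : Function.Injective (toWStar Y) := fun _ _ h =>
  Subtype.ext (StrongDual.toWeakDual.injective h)

theorem mem_closure_wStarOperatorTopology_iff {D : Set (Y →L[ℂ] StrongDual ℂ X)}
    {A : Y →L[ℂ] StrongDual ℂ X} :
    A ∈ closure[wStarOperatorTopology Y] D ↔
      ∃ 𝒰 : Ultrafilter (Y →L[ℂ] StrongDual ℂ X), D ∈ 𝒰 ∧
        ∀ (z : Y) (x : X), Filter.Tendsto (fun B : Y →L[ℂ] StrongDual ℂ X => B z x) 𝒰 (𝓝 (A z x)) := by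
  rw [@mem_closure_iff_ultrafilter _ _ _ (wStarOperatorTopology Y)]
  refine exists_congr fun 𝒰 => and_congr_right fun _ => ?_
  rw [nhds_induced, ← Filter.tendsto_iff_comap, tendsto_pi_nhds]
  exact forall_congr' fun z => WeakDual.tendsto_iff_forall_apply

variable {S : Type*} {T : S → Y →L[ℂ] Y}

theorem compactification_subset_compactificationHull :
    compactification Y T ⊆ compactificationHull Y T := by
  intro U hU
  have h := @closure_mono _ (wStarOperatorTopology Y) _ _
    (subset_absConvexHull (𝕜 := ℂ) (s := Set.range fun t : S => toOpDual Y (T t)))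
  exact h hU

theorem exists_ultrafilter_of_mem_compactification {U : Y →L[ℂ] Y}
    (hU : U ∈ compactification Y T) :
    ∃ 𝒰 : Ultrafilter S, ∀ (z : Y) (x : X),
      Filter.Tendsto (fun s => (T s z : StrongDual ℂ X) x) 𝒰 (𝓝 ((U z : StrongDual ℂ X) x)) := by
  obtain ⟨𝒲, hD, h⟩ := mem_closure_wStarOperatorTopology_iff.1 hU
  obtain ⟨𝒰, h𝒰⟩ := 𝒲.exists_tendsto_of_range_mem hD
  exact ⟨𝒰, fun z x => (h z x).comp h𝒰⟩

variable [TopologicalSpace S] [AddCommMonoid S]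

theorem IsDualRepresentation.apply_comm (hT : IsDualRepresentation Y T) (s t : S) (z : Y) :
    T s (T t z) = T t (T s z) := by
  rw [← ContinuousLinearMap.comp_apply, ← hT.map_add, add_comm, hT.map_add,
    ContinuousLinearMap.comp_apply]

theorem IsDualRepresentation.tendsto_apply (hT : IsDualRepresentation Y T) (t : S) {z u : Y}
    {ι : Type*} {l : Filter ι} [l.NeBot] {w : ι → Y}
    (hw : ∀ᶠ i in l, toWStar Y (w i) ∈ orbitHull Y T z)
    (hlim : Filter.Tendsto (fun i => toWStar Y (w i)) l (𝓝 (toWStar Y u))) :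
    Filter.Tendsto (fun i => toWStar Y (T t (w i))) l (𝓝 (toWStar Y (T t u))) := by
  have hu : u ∈ toWStar Y ⁻¹' orbitHull Y T z := isClosed_closure.mem_of_tendsto hlim hw
  have h1 := hT.continuousOn_orbitHull t z u hu
  have h2 : Filter.Tendsto w l (@nhdsWithin _ (wStarTopology Y) u
      (toWStar Y ⁻¹' orbitHull Y T z)) := by
    refine @tendsto_nhdsWithin_iff _ _ (wStarTopology Y) _ _ _ _ |>.2 ⟨?_, hw⟩
    rw [nhds_induced, Filter.tendsto_comap_iff]
    exact hlim
  have h3 := Filter.Tendsto.comp h1 h2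
  rw [nhds_induced, Filter.tendsto_comap_iff] at h3
  exact h3

/-- The value `A z` lives in the dual of `X`, so `T t` cannot be applied to it directly. The witness
`w` is that value as an element of `Y`, placed in the orbit hull, where `T t` is weak-star
continuous. -/
theorem IsDualRepresentation.comm_of_mem_absConvexHull (hT : IsDualRepresentation Y T) (t : S)
    (z : Y) {A : Y →L[ℂ] StrongDual ℂ X}
    (hA : A ∈ absConvexHull ℂ (Set.range fun s : S => toOpDual Y (T s))) :
    ∃ w : Y, toWStar Y w ∈ absConvexHull ℂ (orbit Y T z) ∧ (w : StrongDual ℂ X) = A z ∧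
      (T t w : StrongDual ℂ X) = A (T t z) := by
  revert A
  have hac := absConvex_absConvexHull (𝕜 := ℂ) (s := orbit Y T z)
  refine absConvexHull_min (t := {A : Y →L[ℂ] StrongDual ℂ X | ∃ w : Y, toWStar Y w ∈ absConvexHull ℂ (orbit Y T z) ∧
    (w : StrongDual ℂ X) = A z ∧ (T t w : StrongDual ℂ X) = A (T t z)}) ?_ ⟨?_, ?_⟩
  · rintro _ ⟨s, rfl⟩
    exact ⟨T s z, subset_absConvexHull ⟨s, rfl⟩, rfl, congrArg _ (hT.apply_comm t s z)⟩
  · rw [balanced_iff_smul_mem]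
    rintro a ha A ⟨w, h1, h2, h3⟩
    refine ⟨a • w, balanced_iff_smul_mem.1 hac.1 ha h1, ?_, ?_⟩
    · simp [h2]
    · simp [h3]
  · rintro A ⟨w, h1, h2, h3⟩ A' ⟨w', h1', h2', h3'⟩ a b ha hb hab
    refine ⟨a • w + b • w', hac.2 h1 h1' ha hb hab, ?_, ?_⟩
    · simp [h2, h2']
    · simp [h3, h3']

/-- Commutation with `T t` holds on the absolutely convex hull and survives the limit because the
approximants of `U z` stay in the orbit hull of `z`. -/
theorem IsDualRepresentation.comm_of_mem_compactificationHull (hT : IsDualRepresentation Y T)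
    {U : Y →L[ℂ] Y} (hU : U ∈ compactificationHull Y T) (t : S) (z : Y) :
    T t (U z) = U (T t z) := by
  classical
  obtain ⟨𝒰, hD, h⟩ := mem_closure_wStarOperatorTopology_iff.1 hU
  choose! w hw1 hw2 hw3 using fun A hA => hT.comm_of_mem_absConvexHull t z (A := A) hA
  have hD' : ∀ᶠ A in (𝒰 : Filter _), A ∈ absConvexHull ℂ (Set.range fun s : S =>
    toOpDual Y (T s)) := hD
  have hw : ∀ᶠ A in (𝒰 : Filter (Y →L[ℂ] StrongDual ℂ X)), toWStar Y (w A) ∈ orbitHull Y T z :=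
    hD'.mono fun A hA => subset_closure (hw1 A hA)
  have h1 := hT.tendsto_apply t (u := U z) hw (by
      rw [WeakDual.tendsto_iff_forall_apply]
      intro x
      refine (h z x).congr' (hD'.mono fun A hA => ?_)
      show A z x = (w A : StrongDual ℂ X) x
      rw [hw2 A hA])
  apply toWStar_injective
  refine tendsto_nhds_unique h1 ?_
  rw [WeakDual.tendsto_iff_forall_apply]
  intro x
  refine (h (T t z) x).congr' (hD'.mono fun A hA => ?_)
  show A (T t z) x = (T t (w A) : StrongDual ℂ X) x
  rw [hw3 A hA]

/-- A bounded dual representation extends to the Stone–Čech compactification of `S`. -/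
theorem IsDualRepresentation.exists_stoneCech_extension (hT : IsDualRepresentation Y T) {C : ℝ}
    (hC : ∀ (s : S) (z : Y), ‖T s z‖ ≤ C * ‖z‖) :
    ∃ U : StoneCech S → Y →L[ℂ] Y, (∀ p, U p ∈ compactification Y T) ∧
      (∀ s, U (stoneCechUnit s) = T s) ∧ (∀ p z, ‖U p z‖ ≤ C * ‖z‖) ∧
      ∀ (z : Y) (x : X), Continuous fun p => (U p z : StrongDual ℂ X) x := by
  have h1 : ∀ z : Y, ∃ E : StoneCech S → WeakDual ℂ X, Continuous E ∧
      (∀ s, E (stoneCechUnit s) = toWStar Y (T s z)) ∧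
      ∀ p, ‖WeakDual.toStrongDual (E p)‖ ≤ C * ‖z‖ := by
    intro z
    let W : Set (WeakDual ℂ X) := WeakDual.toStrongDual ⁻¹' Metric.closedBall 0 (C * ‖z‖)
    have : CompactSpace W := isCompact_iff_compactSpace.1 (WeakDual.isCompact_closedBall _ _)
    let g : S → W := fun s => ⟨toWStar Y (T s z), mem_closedBall_zero_iff.2 (hC s z)⟩
    have hg : Continuous g := Continuous.subtype_mk
      (WeakDual.continuous_of_continuous_eval fun x => hT.continuous_coeff x z) _
    refine ⟨fun p => (stoneCechExtend hg p).1,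
      continuous_subtype_val.comp (continuous_stoneCechExtend hg), fun s => ?_, fun p => ?_⟩
    · exact congrArg Subtype.val (congrFun (stoneCechExtend_extends hg) s)
    · exact mem_closedBall_zero_iff.1 (stoneCechExtend hg p).2
  choose E hEc hEu hEb using h1
  -- The closed orbit lies in `Y`, which lets the extended operators take values in `Y` and not just
  -- in the dual of `X`.
  have hrange : ∀ z p, ∃ w : Y, toWStar Y w = E z p := by
    intro z p
    apply hT.closure_orbit_subset z
    have h2 : E z p ∈ closure (E z '' Set.range stoneCechUnit) :=
      image_closure_subset_closure_image (hEc z) ⟨p, denseRange_stoneCechUnit p, rfl⟩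
    rw [← Set.range_comp] at h2
    have h3 : (E z ∘ stoneCechUnit) = fun t : S => toWStar Y (T t z) := funext (hEu z)
    rwa [h3] at h2
  choose w hw using hrange
  have hadd : ∀ z z' p, E (z + z') p = E z p + E z' p := by
    intro z z' p
    refine congrFun (DenseRange.equalizer (g := E (z + z')) (h := fun p => E z p + E z' p)
      denseRange_stoneCechUnit (hEc _) ((hEc z).add (hEc z')) (funext fun s => ?_)) p
    simp only [Function.comp_apply, hEu]
    exact congrArg (toWStar Y) ((T s).map_add z z')
  have hsmul : ∀ (c : ℂ) z p, E (c • z) p = c • E z p := by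
    intro c z p
    refine congrFun (DenseRange.equalizer (g := E (c • z)) (h := fun p => c • E z p)
      denseRange_stoneCechUnit (hEc _) ((hEc z).const_smul c) (funext fun s => ?_)) p
    simp only [Function.comp_apply, hEu, map_smul]
    rfl
  have hnorm : ∀ p z, ‖w z p‖ ≤ C * ‖z‖ := fun p z => by
    have := hEb z p
    rwa [← hw] at this
  let U : StoneCech S → Y →L[ℂ] Y := fun p => LinearMap.mkContinuous
    { toFun := fun z => w z p
      map_add' := fun z z' => toWStar_injective (by rw [hw, hadd, ← hw, ← hw]; rfl)
      map_smul' := fun c z => toWStar_injective (by rw [hw, hsmul, ← hw]; rfl) } C (hnorm p)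
  have hUE : ∀ p z, toWStar Y (U p z) = E z p := fun p z => hw z p
  have hcont : ∀ (z : Y) (x : X), Continuous fun p => (U p z : StrongDual ℂ X) x := by
    intro z x
    have h4 : (fun p => (U p z : StrongDual ℂ X) x) = fun p => E z p x := by
      funext p
      rw [← hUE]
      rfl
    rw [h4]
    exact (WeakDual.eval_continuous x).comp (hEc z)
  have hunit : ∀ s, U (stoneCechUnit s) = T s := fun s => by
    ext1 z
    exact toWStar_injective ((hUE _ _).trans (hEu z s))
  refine ⟨U, fun p => ?_, hunit, hnorm, hcont⟩
  have hUc : @Continuous _ _ _ (wStarOperatorTopology Y) fun p => toOpDual Y (U p) := by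
    refine continuous_induced_rng.2 (continuous_pi fun z => ?_)
    exact WeakDual.continuous_of_continuous_eval fun x => hcont z x
  have h5 := @image_closure_subset_closure_image _ _ _ (wStarOperatorTopology Y)
    (fun p => toOpDual Y (U p)) (Set.range stoneCechUnit) hUc
  rw [← Set.range_comp] at h5
  have h6 : ((fun p => toOpDual Y (U p)) ∘ stoneCechUnit) = fun t : S => toOpDual Y (T t) :=
    funext fun s => congrArg _ (hunit s)
  rw [h6] at h5
  exact h5 ⟨p, denseRange_stoneCechUnit p, rfl⟩

omit [AddCommMonoid S] in
/-- Operators in the hull of the compactification are represented by functionals on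
`C(StoneCech S)`. -/
theorem exists_weakDual_of_mem_compactificationHull {U : StoneCech S → Y →L[ℂ] Y}
    (hunit : ∀ s, U (stoneCechUnit s) = T s)
    (hcont : ∀ (z : Y) (x : X), Continuous fun p => (U p z : StrongDual ℂ X) x)
    {V : Y →L[ℂ] Y} (hV : V ∈ compactificationHull Y T) :
    ∃ φ ∈ closure (absConvexHull ℂ (Set.range (evalWeakDual (StoneCech S)))),
      ∀ (z : Y) (x : X), φ ⟨_, hcont z x⟩ = (V z : StrongDual ℂ X) x := by
  have hac := absConvex_absConvexHull (𝕜 := ℂ) (s := Set.range (evalWeakDual (StoneCech S)))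
  have hrep : absConvexHull ℂ (Set.range fun s : S => toOpDual Y (T s)) ⊆
      {A | ∃ δ ∈ absConvexHull ℂ (Set.range (evalWeakDual (StoneCech S))),
        ∀ (z : Y) (x : X), δ ⟨_, hcont z x⟩ = A z x} := by
    refine absConvexHull_min ?_ ⟨?_, ?_⟩
    · rintro _ ⟨s, rfl⟩
      refine ⟨evalWeakDual _ (stoneCechUnit s), subset_absConvexHull ⟨_, rfl⟩, fun z x => ?_⟩
      rw [evalWeakDual_apply, ContinuousMap.coe_mk, hunit]
      rfl
    · rw [balanced_iff_smul_mem]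
      rintro a ha A ⟨δ, h1, h2⟩
      refine ⟨a • δ, balanced_iff_smul_mem.1 hac.1 ha h1, fun z x => ?_⟩
      show a • δ _ = a • A z x
      rw [h2]
    · rintro A ⟨δ, h1, h2⟩ A' ⟨δ', h1', h2'⟩ a b ha hb hab
      refine ⟨a • δ + b • δ', hac.2 h1 h1' ha hb hab, fun z x => ?_⟩
      show a • δ _ + b • δ' _ = a • A z x + b • A' z x
      rw [h2, h2']
  obtain ⟨𝒰, hD, h⟩ := mem_closure_wStarOperatorTopology_iff.1 hV
  choose! δ hδ1 hδ2 using hrep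
  have hD' : ∀ᶠ A in (𝒰 : Filter _), A ∈ absConvexHull ℂ (Set.range fun s : S =>
    toOpDual Y (T s)) := hD
  obtain ⟨φ, -, hφ⟩ := (WeakDual.isCompact_closedBall (𝕜 := ℂ) (E := C(StoneCech S, ℂ)) 0
    1).ultrafilter_le_nhds (𝒰.map δ) (Filter.le_principal_iff.2
      (hD'.mono fun A hA => absConvexHull_evalWeakDual_subset (hδ1 hA)))
  have hφ' : Filter.Tendsto δ 𝒰 (𝓝 φ) := hφ
  refine ⟨φ, mem_closure_of_tendsto hφ' (hD'.mono fun A hA => hδ1 hA), fun z x => ?_⟩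
  refine tendsto_nhds_unique (WeakDual.tendsto_iff_forall_apply.1 hφ' _) ((h z x).congr' ?_)
  exact hD'.mono fun A hA => (hδ2 hA z x).symm

/-- Restriction of continuous functions along the map `S → StoneCech S`. -/
noncomputable def restrictStoneCech (S : Type*) [TopologicalSpace S] :
    C(StoneCech S, ℂ) →L[ℂ] (S →ᵇ ℂ) :=
  LinearMap.mkContinuous
    { toFun := fun h => (BoundedContinuousFunction.mkOfCompact h).compContinuous
        ⟨stoneCechUnit, continuous_stoneCechUnit⟩
      map_add' := fun _ _ => rfl
      map_smul' := fun _ _ => rfl } 1 fun h => by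
    rw [one_mul]
    exact (BoundedContinuousFunction.norm_le (norm_nonneg _)).2 fun s => h.norm_coe_le_norm _

theorem restrictStoneCech_apply {S : Type*} [TopologicalSpace S] (h : C(StoneCech S, ℂ)) (s : S) :
    restrictStoneCech S h s = h (stoneCechUnit s) := rfl

/-! ### Commutation and weak almost periodicity. -/

theorem IsDualRepresentation.isEberleinWAP [SeparatelyContinuousAdd S]
    (hT : IsDualRepresentation Y T) {C : ℝ} (hC0 : 0 ≤ C)
    (hC : ∀ (s : S) (z : Y), ‖T s z‖ ≤ C * ‖z‖) {y : Y}
    (hcomm : ∀ U ∈ compactification Y T, ∀ V ∈ compactification Y T, U (V y) = V (U y)) (x : X) :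
    IsEberleinWAP fun s : S => (T s y : StrongDual ℂ X) x := by
  obtain ⟨U, hU, hunit, hnorm, hcont⟩ := hT.exists_stoneCech_extension hC
  let F : StoneCech S → C(StoneCech S, ℂ) := fun p => ⟨_, hcont (U p y) x⟩
  have hF : ∀ φ : StrongDual ℂ C(StoneCech S, ℂ), Continuous fun p => φ (F p) := by
    refine continuous_strongDual_apply_of_separately_continuous (C := C * (C * ‖y‖) * ‖x‖) F
      (fun q => ?_) (fun p q => ?_)
    -- The only place where commutation enters: it moves the variable `p` to the outer operator,
    -- where continuity is known.
    · refine (hcont (U q y) x).congr fun p => ?_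
      show _ = (U q (U p y) : StrongDual ℂ X) x
      rw [hcomm _ (hU p) _ (hU q)]
    · refine ((U q (U p y) : StrongDual ℂ X).le_opNorm x).trans ?_
      gcongr
      refine (hnorm q _).trans ?_
      gcongr
      exact hnorm p y
  refine ⟨restrictStoneCech S ⟨_, hcont y x⟩, fun s => ?_, ?_⟩
  · rw [restrictStoneCech_apply, ContinuousMap.coe_mk, hunit]
  · have hg : Continuous fun p => toWeakSpace ℂ (S →ᵇ ℂ) (restrictStoneCech S (F p)) :=
      WeakBilin.continuous_of_continuous_eval _ fun φ => hF (φ ∘L restrictStoneCech S)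
    refine (isCompact_range hg).closure_of_subset ?_
    rintro _ ⟨t, rfl⟩
    refine ⟨stoneCechUnit t, congrArg _ ?_⟩
    ext s
    show (U (stoneCechUnit s) (U (stoneCechUnit t) y) : StrongDual ℂ X) x =
      (U (stoneCechUnit (t + s)) y : StrongDual ℂ X) x
    rw [hunit, hunit, hunit, hT.map_add, ContinuousLinearMap.comp_apply, hT.apply_comm]

theorem IsDualRepresentation.comm_compactificationHull (hT : IsDualRepresentation Y T) {C : ℝ}
    (hC0 : 0 ≤ C) (hC : ∀ (s : S) (z : Y), ‖T s z‖ ≤ C * ‖z‖) {y : Y}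
    (hcomm : ∀ U ∈ compactification Y T, ∀ V ∈ compactification Y T, U (V y) = V (U y))
    {V W : Y →L[ℂ] Y} (hV : V ∈ compactificationHull Y T) (hW : W ∈ compactificationHull Y T) :
    V (W y) = W (V y) := by
  obtain ⟨U, hU, hunit, hnorm, hcont⟩ := hT.exists_stoneCech_extension hC
  apply Subtype.ext
  ext x
  let F : StoneCech S → C(StoneCech S, ℂ) := fun p => ⟨_, hcont (U p y) x⟩
  have hsymm : ∀ p q, F p q = F q p := fun p q => by
    show (U q (U p y) : StrongDual ℂ X) x = (U p (U q y) : StrongDual ℂ X) x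
    rw [hcomm _ (hU p) _ (hU q)]
  have hFb : ∀ p q, ‖F p q‖ ≤ C * (C * ‖y‖) * ‖x‖ := fun p q => by
    refine ((U q (U p y) : StrongDual ℂ X).le_opNorm x).trans ?_
    gcongr
    refine (hnorm q _).trans ?_
    gcongr
    exact hnorm p y
  have hF : ∀ φ : StrongDual ℂ C(StoneCech S, ℂ), Continuous fun p => φ (F p) :=
    continuous_strongDual_apply_of_separately_continuous F
      (fun q => (F q).continuous.congr fun p => hsymm q p) hFb
  -- For `p` in `S` this is commutation of `R` with `T t`; density extends it to all `p`, the right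
  -- side being continuous by Grothendieck's theorem.
  have hcoeff : ∀ {R : Y →L[ℂ] Y}, R ∈ compactificationHull Y T →
      ∀ ψ : WeakDual ℂ C(StoneCech S, ℂ),
      (∀ (z : Y) (x : X), ψ ⟨_, hcont z x⟩ = (R z : StrongDual ℂ X) x) →
      ∀ p, (⟨_, hcont (R y) x⟩ : C(StoneCech S, ℂ)) p = WeakDual.toStrongDual ψ (F p) := by
    intro R hR ψ hψ p
    refine congrFun (DenseRange.equalizer denseRange_stoneCechUnit (hcont (R y) x)
      (hF (WeakDual.toStrongDual ψ)) (funext fun t => ?_)) p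
    show (U (stoneCechUnit t) (R y) : StrongDual ℂ X) x = ψ ⟨_, hcont (U (stoneCechUnit t) y) x⟩
    rw [hψ, hunit, hT.comm_of_mem_compactificationHull hR]
  obtain ⟨φ, hφ, hφV⟩ := exists_weakDual_of_mem_compactificationHull hunit hcont hV
  obtain ⟨ψ, -, hψW⟩ := exists_weakDual_of_mem_compactificationHull hunit hcont hW
  rw [← hφV, ← hψW]
  exact strongDual_fubini_of_separately_continuous F F hsymm hFb (WeakDual.toStrongDual ψ) hφ _
    (hcoeff hW ψ hψW) _ (hcoeff hV φ hφV)

/-- Grothendieck's double limit argument for a single `x`: with `g` the weak limit of the translates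
along `𝒰` and `φ` the weak-star limit of the evaluations along `𝒱`, both sides equal `φ g`. -/
theorem IsDualRepresentation.apply_comm_of_isEberleinWAP [SeparatelyContinuousAdd S]
    (hT : IsDualRepresentation Y T) {y : Y} {x : X}
    (hx : IsEberleinWAP fun s : S => (T s y : StrongDual ℂ X) x) {U V : Y →L[ℂ] Y}
    (hU : U ∈ compactification Y T) (hV : V ∈ compactification Y T) :
    (U (V y) : StrongDual ℂ X) x = (V (U y) : StrongDual ℂ X) x := by
  obtain ⟨f, hf, hcomp⟩ := hx
  have hcU := hT.comm_of_mem_compactificationHull (compactification_subset_compactificationHull hU)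
  have hcV := hT.comm_of_mem_compactificationHull (compactification_subset_compactificationHull hV)
  obtain ⟨𝒰, h𝒰⟩ := exists_ultrafilter_of_mem_compactification hU
  obtain ⟨𝒱, h𝒱⟩ := exists_ultrafilter_of_mem_compactification hV
  have htr : ∀ s t, translate f t s = (T t (T s y) : StrongDual ℂ X) x := fun s t => by
    show f (t + s) = _
    refine (hf _).trans ?_
    show (T (t + s) y : StrongDual ℂ X) x = _
    rw [hT.map_add]
    rfl
  obtain ⟨g, -, hg⟩ := hcomp.ultrafilter_le_nhds
    (𝒰.map fun t : S => toWeakSpace ℂ (S →ᵇ ℂ) (translate f t))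
    (Filter.le_principal_iff.2 (Filter.mem_map.2
      (Filter.Eventually.of_forall fun t => subset_closure ⟨t, rfl⟩)))
  have hg' : ∀ φ : StrongDual ℂ (S →ᵇ ℂ), Filter.Tendsto (fun t => φ (translate f t)) 𝒰
      (𝓝 (φ ((toWeakSpace ℂ (S →ᵇ ℂ)).symm g))) := fun φ =>
    ((WeakBilin.eval_continuous (topDualPairing ℂ (S →ᵇ ℂ)).flip φ).tendsto g).comp hg
  let ev : S → WeakDual ℂ (S →ᵇ ℂ) := fun s =>
    StrongDual.toWeakDual (BoundedContinuousFunction.evalCLM ℂ s)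
  obtain ⟨φ, -, hφ⟩ := (WeakDual.isCompact_closedBall (𝕜 := ℂ) (E := S →ᵇ ℂ) 0
    1).ultrafilter_le_nhds (𝒱.map ev) (Filter.le_principal_iff.2
      (Filter.mem_map.2 (Filter.Eventually.of_forall fun s => by
        simp only [Set.mem_preimage, mem_closedBall_zero_iff]
        refine ContinuousLinearMap.opNorm_le_bound _ zero_le_one fun h => ?_
        rw [one_mul]
        exact h.norm_coe_le_norm s)))
  have hφ' : ∀ h : S →ᵇ ℂ, Filter.Tendsto (fun s => h s) 𝒱 (𝓝 (φ h)) :=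
    WeakDual.tendsto_iff_forall_apply.1 (show Filter.Tendsto ev 𝒱 (𝓝 φ) from hφ)
  have e1 : ∀ t, φ (translate f t) = (T t (V y) : StrongDual ℂ X) x := fun t => by
    refine tendsto_nhds_unique (hφ' _) ?_
    rw [hcV]
    refine (h𝒱 (T t y) x).congr fun s => ?_
    rw [htr, hT.apply_comm]
  have e2 : φ ((toWeakSpace ℂ (S →ᵇ ℂ)).symm g) = (U (V y) : StrongDual ℂ X) x :=
    tendsto_nhds_unique (hg' (WeakDual.toStrongDual φ))
      ((h𝒰 (V y) x).congr fun t => (e1 t).symm)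
  have e3 : ∀ s, (toWeakSpace ℂ (S →ᵇ ℂ)).symm g s = (T s (U y) : StrongDual ℂ X) x := fun s => by
    refine tendsto_nhds_unique (hg' (BoundedContinuousFunction.evalCLM ℂ s)) ?_
    rw [hcU]
    exact (h𝒰 (T s y) x).congr fun t => (htr s t).symm
  rw [← e2]
  exact tendsto_nhds_unique (hφ' _) ((h𝒱 (U y) x).congr fun s => (e3 s).symm)

end DualRep

theorem theorem3p13 {S : Type*} [TopologicalSpace S] [T2Space S] [AddCommMonoid S]
    [SeparatelyContinuousAdd S] {X : Type*} [NormedAddCommGroup X] [NormedSpace ℂ X]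
    [CompleteSpace X] (Y : Submodule ℂ (StrongDual ℂ X)) (T : S → Y →L[ℂ] Y)
    (hT : DualRep.IsDualRepresentation Y T) (hbdd : ∃ C : ℝ, ∀ (s : S) (z : Y), ‖T s z‖ ≤ C * ‖z‖) (y : Y) :
    ((∀ U ∈ DualRep.compactification Y T, ∀ V ∈ DualRep.compactification Y T,
        U (V y) = V (U y)) ↔
      ∃ M : Set X, DualRep.IsSeparating Y M ∧
        ∀ x ∈ M, DualRep.IsEberleinWAP fun s : S => (T s y : StrongDual ℂ X) x) ∧
    ((∀ U ∈ DualRep.compactification Y T, ∀ V ∈ DualRep.compactification Y T,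
        U (V y) = V (U y)) →
      ∀ U ∈ DualRep.compactificationHull Y T, ∀ V ∈ DualRep.compactificationHull Y T,
        U (V y) = V (U y)) := by
  obtain ⟨C, hC⟩ : ∃ C : ℝ, 0 ≤ C ∧ ∀ (s : S) (z : Y), ‖T s z‖ ≤ C * ‖z‖ := by
    obtain ⟨C, hC⟩ := hbdd
    exact ⟨max C 0, le_max_right _ _, fun s z => (hC s z).trans
      (mul_le_mul_of_nonneg_right (le_max_left _ _) (norm_nonneg z))⟩
  refine ⟨⟨fun hcomm => ⟨Set.univ, fun z hz => Subtype.ext ?_, fun x _ =>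
    hT.isEberleinWAP hC.1 hC.2 hcomm x⟩, ?_⟩, fun hcomm U hU V hV =>
    hT.comm_compactificationHull hC.1 hC.2 hcomm hU hV⟩
  · ext x
    exact hz x (Set.mem_univ x)
  · rintro ⟨M, hM, hW⟩ U hU V hV
    rw [← sub_eq_zero]
    refine hM _ fun x hx => ?_
    have := hT.apply_comm_of_isEberleinWAP (hW x hx) hU hV
    simp [this]
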